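/- Let $n_1,\dots,n_d$ be positive integers with $n=\sum_{i=1}^{d}n_i$ and $k=\sum_{i=1}^{d-1}n_i$. A point of the flag manifold $FL(n_1,\dots,n_d)$ is written $[x]$, where $x$ is an $n\times k$ matrix with orthonormal columns, taken modulo right multiplication by block diagonal matrices in $O(n_1)\times\cdots\times O(n_{d-1})$. Let $I_{n,k}$ be the first $k$ columns of the $n\times n$ identity matrix. Call $H\in\mathbb R^{n\times n}$ horizontal if $$H=\begin{bmatrix}A&-B^T\\B&0\end{bmatrix},$$ where $A\in\mathbb R^{k\times k}$ is skew-symmetric with vanishing diagonal blocks of sizes $n_1,\dots,n_{d-1}$ and $B\in\mathbb R^{(n-k)\times k}$. Geodesic flows are the curves $t\mapsto Q\exp(tH)I_{n,k}$ with $Q\in SO(n)$ and $H$ horizontal; they represent the geodesics of $FL(n_1,\dots,n_d)$, and the length of such a geodesic over $0\le t\le 1$ is $\sqrt{\tfrac12\mathrm{Tr}(H^TH)}$. Let $d(x,y)$ be the infimum of the lengths of the geodesics from $[x]$ at time $0$ to $[y]$ at time $1$, and let $\mathrm{Log}(x,y)$ be the set of initial velocities $QHI_{n,k}$ of the geodesic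 flows that start at $x$ at time $0$, represent $[y]$ at time $1$, and have length $d(x,y)$. The same notions are used for $FL(n_1,\dots,n_{d-1},k)$, in dimension $2k$. Let $q(t)=\exp(tH)I_{n,k}$ with $H$ horizontal, so that $q(0)=I_{n,k}$; put $q=q(1)$, and suppose that $\mathrm{span}\{q(0)\}\cap\mathrm{span}\{q(1)\}=\{0\}$, where $\mathrm{span}$ denotes the span of the columns. Let $[I_{n,k},q]=UR$, where $U$ is an $n\times 2k$ matrix with orthonormal columns and $R$ is a $2k\times 2k$ matrix (for example the compact QR decomposition, in which $R$ is upper triangular). Then $\phi(t)=U^Tq(t)$ has orthonormal columns for every $t$ and is a geodesic flow on $FL(n_1,\dots,n_{d-1},k)$ from $\phi(0)=U^Tq(0)$ to $\phi(1)=U^Tq(1)$. Moreover, $$d(\phi(0),\phi(1))=d(q(0),q(1)),\qquad q(t)=U\phi(t)=UU^Tq(t)\ \text{ for all }t,$$ and $\mathrm{Log}(q(0),q(1))=\{U\Delta:\Delta\in\mathrm{Log}(\phi(0),\phi(1))\}$, so that the logarithm and the distance can be computed with $2k\times 2k$ matrices. -/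

import Mathlib

namespace FlagGeod

open Matrix

/-- Indices of the first `k = n₁ + ⋯ + n_m` coordinates, grouped in `m` consecutive blocks, the
`i`-th one of size `n i`.  (A flag of type `(n₁, …, n_m, p)` has `d = m + 1` blocks.) -/
abbrev Head {m : ℕ} (n : Fin m → ℕ) : Type := Σ i : Fin m, Fin (n i)

/-- Indices of all `n₁ + ⋯ + n_m + p` coordinates of the ambient space for flags of type
`(n₁, …, n_m, p)`; the last block has size `p`. -/
abbrev Idx {m : ℕ} (n : Fin m → ℕ) (p : ℕ) : Type := Head n ⊕ Fin p

/-- `I_{N,k}`: the first `k` columns of the `N × N` identity matrix, where `k = n₁ + ⋯ + n_m` and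
`N = k + p`. -/
def idCols {m : ℕ} (n : Fin m → ℕ) (p : ℕ) : Matrix (Idx n p) (Head n) ℝ :=
  fromRows 1 0

/-- Orthonormal `N × k` matrices, `k = n₁ + ⋯ + n_m`, `N = k + p` (the Stiefel manifold). -/
def Stiefel {m : ℕ} (n : Fin m → ℕ) (p : ℕ) : Type :=
  {q : Matrix (Idx n p) (Head n) ℝ // qᵀ * q = 1}

/-- The action of `O(n₁) × ⋯ × O(n_m)` by right multiplication with block diagonal matrices:
two orthonormal `N × k` matrices are equivalent when they are in the same orbit, that is, when
their column blocks define the same flag. -/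
instance flagSetoid {m : ℕ} (n : Fin m → ℕ) (p : ℕ) : Setoid (Stiefel n p) where
  r x y := ∃ M : (i : Fin m) → Matrix (Fin (n i)) (Fin (n i)) ℝ,
    (∀ i, M i ∈ orthogonalGroup (Fin (n i)) ℝ) ∧ y.1 = x.1 * blockDiagonal' M
  iseqv :=
    { refl := fun x => ⟨fun _ => 1, fun _ => one_mem _, by
        have h : blockDiagonal' (fun i : Fin m => (1 : Matrix (Fin (n i)) (Fin (n i)) ℝ)) = 1 :=
          blockDiagonal'_one
        rw [h, Matrix.mul_one]⟩
      symm := by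
        rintro x y ⟨M, hM, h⟩
        refine ⟨fun i => star (M i), fun i => Unitary.star_mem (hM i), ?_⟩
        have h1 : (fun i => M i * star (M i)) = fun i : Fin m =>
            (1 : Matrix (Fin (n i)) (Fin (n i)) ℝ) :=
          funext fun i => (mem_orthogonalGroup_iff (Fin (n i)) ℝ).1 (hM i)
        have h2 : blockDiagonal' (fun i : Fin m => (1 : Matrix (Fin (n i)) (Fin (n i)) ℝ)) = 1 :=
          blockDiagonal'_one
        rw [h, Matrix.mul_assoc, ← blockDiagonal'_mul, h1, h2, Matrix.mul_one]
      trans := by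
        rintro x y z ⟨M, hM, h⟩ ⟨M', hM', h'⟩
        refine ⟨fun i => M i * M' i, fun i => mul_mem (hM i) (hM' i), ?_⟩
        rw [h', h, Matrix.mul_assoc, ← blockDiagonal'_mul] }

/-- The flag manifold `FL(n₁, …, n_m, p)` of flags of type `(n₁, …, n_m, p)` in dimension
`n₁ + ⋯ + n_m + p`, as the quotient of the Stiefel manifold by `O(n₁) × ⋯ × O(n_m)`
(the last block of a full orthogonal representative is the free orthogonal complement). -/
def FL {m : ℕ} (n : Fin m → ℕ) (p : ℕ) : Type := Quotient (flagSetoid n p)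

/-- The flag `[q]` represented by an orthonormal `N × k` matrix `q`. -/
def Stiefel.toFL {m : ℕ} {n : Fin m → ℕ} {p : ℕ} (q : Stiefel n p) : FL n p :=
  Quotient.mk (flagSetoid n p) q

/-- Horizontal matrices for `FL(n₁, …, n_m, p)`: the skew-symmetric matrices whose `m + 1`
diagonal blocks (of sizes `n₁, …, n_m, p`) vanish, in the form `[A, -Bᵀ; B, 0]`. -/
def IsHorizontal {m : ℕ} {n : Fin m → ℕ} {p : ℕ}
    (H : Matrix (Idx n p) (Idx n p) ℝ) : Prop :=
  ∃ (A : Matrix (Head n) (Head n) ℝ) (B : Matrix (Fin p) (Head n) ℝ),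
    Aᵀ = -A ∧ (∀ (i : Fin m) (a b : Fin (n i)), A ⟨i, a⟩ ⟨i, b⟩ = 0) ∧
    H = fromBlocks A (-Bᵀ) B 0

/-- `γ` is the flow `γ(t) = Q exp(tH) I_{N,k}` of orthonormal `N × k` matrices which represents
the geodesic with starting point `[Q]`, `Q ∈ SO(N)`, and horizontal direction `H`. -/
def IsGeodesicFlow {m : ℕ} {n : Fin m → ℕ} {p : ℕ} (γ : ℝ → Stiefel n p)
    (Q H : Matrix (Idx n p) (Idx n p) ℝ) : Prop :=
  Q ∈ specialOrthogonalGroup (Idx n p) ℝ ∧ IsHorizontal H ∧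
    ∀ t : ℝ, (γ t).1 = Q * NormedSpace.exp (t • H) * idCols n p

/-- Geodesics of the flag manifold: the curves `t ↦ [Q exp(tH)]`. -/
def IsGeodesic {m : ℕ} {n : Fin m → ℕ} {p : ℕ} (c : ℝ → FL n p) : Prop :=
  ∃ (γ : ℝ → Stiefel n p) (Q H : Matrix (Idx n p) (Idx n p) ℝ),
    IsGeodesicFlow γ Q H ∧ ∀ t, c t = (γ t).toFL

/-- The norm `√(½ Tr(HᵀH))`; for horizontal `H` it is the length over `0 ≤ t ≤ 1` of the geodesic
`t ↦ [Q exp(tH)]`. -/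
noncomputable def tangentNorm {ι : Type} [Fintype ι] (H : Matrix ι ι ℝ) : ℝ :=
  Real.sqrt ((1 / 2) * (Hᵀ * H).trace)

/-- The geodesic distance on the flag manifold: the infimum of the lengths of all geodesics that
start at `x` at time `0` and arrive at `y` at time `1`. -/
noncomputable def flagDist {m : ℕ} {n : Fin m → ℕ} {p : ℕ} (x y : FL n p) : ℝ :=
  sInf {l : ℝ | ∃ (γ : ℝ → Stiefel n p) (Q H : Matrix (Idx n p) (Idx n p) ℝ),
    IsGeodesicFlow γ Q H ∧ (γ 0).toFL = x ∧ (γ 1).toFL = y ∧ l = tangentNorm H}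

/-- The (multivalued) logarithm at the representative `x` of `[y]`: the initial velocities
`Q H I_{N,k}` of the shortest geodesic flows that start at `x` and reach `[y]` at time `1`. -/
def flagLog {m : ℕ} {n : Fin m → ℕ} {p : ℕ} (x y : Stiefel n p) :
    Set (Matrix (Idx n p) (Head n) ℝ) :=
  {D | ∃ (γ : ℝ → Stiefel n p) (Q H : Matrix (Idx n p) (Idx n p) ℝ),
    IsGeodesicFlow γ Q H ∧ γ 0 = x ∧ (γ 1).toFL = y.toFL ∧
    tangentNorm H = flagDist x.toFL y.toFL ∧ D = Q * H * idCols n p}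

/-- The span of the columns of a matrix. -/
def colSpan {ι κ : Type} (M : Matrix ι κ ℝ) : Submodule ℝ (ι → ℝ) :=
  Submodule.span ℝ (Set.range M.col)

end FlagGeod

/-!
Left multiplication by `U` maps geodesic flows of the small flag manifold to geodesic flows of the
large one, and every geodesic flow of the large one arises in this way if its end points lie in the
range of `U` and have column spans meeting only in `0`. Lengths are preserved and initial velocities
are multiplied by `U`. Equality of the distances and of the logarithms is then a comparison of the
sets of admissible flows.

The correspondence rests on one intertwining relation. If `Q` and `Q'` are orthogonal with
`Q I = U Q' I`, then `U Q' = Q W` with `W = diag(1, V)` and `VᵀV = 1` (`exists_blockDiag_frame`).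
For horizontal directions `H = [A, -Bᵀ; B, 0]` and `H' = [A, -B'ᵀ; B', 0]` with `B = V B'` one has
`H W = W H'`, hence `exp(tH) W = W exp(tH')`, and `Q exp(tH) I = U Q' exp(tH') I`
(`flow_eq_of_frame`).

A flow of the small manifold is lifted by taking `B = V B'` (`IsGeodesicFlow.exists_lift`).
Conversely (`IsGeodesicFlow.exists_restrict`), the columns of `B` have to be shown to lie in the
range of `V`. The matrix `P = diag(1, B)` satisfies `H P = P K` for a `2k × 2k` matrix `K`, so
`exp(H) I = [E; B Z]` with `Z` of size `k × k` (`exists_exp_mul_idCols`). Since the spans of the two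
end points meet only in `0`, `Z` is injective, hence invertible; as the end point lies in the range
of `U`, the columns of `B Z`, and therefore those of `B`, lie in the range of `V`.
-/

namespace FlagGeod

open Matrix

/-! ### Matrix exponentials and orthogonal completions -/

/-- Intertwining relations pass to exponentials, also for rectangular intertwiners. -/
theorem exp_mul_of_mul_eq_mul {ι κ : Type*} [Fintype ι] [DecidableEq ι] [Fintype κ]
    [DecidableEq κ] {H : Matrix ι ι ℝ} {K : Matrix κ κ ℝ} {W : Matrix ι κ ℝ}
    (h : H * W = W * K) : NormedSpace.exp H * W = W * NormedSpace.exp K := by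
  have hpow : ∀ j : ℕ, H ^ j * W = W * K ^ j := by
    intro j
    induction j with
    | zero => simp
    | succ j ih => rw [pow_succ, pow_succ', Matrix.mul_assoc, h, ← Matrix.mul_assoc, ih,
        Matrix.mul_assoc, ← pow_succ, ← pow_succ']
  have hH : HasSum (fun j : ℕ => ((j.factorial : ℝ)⁻¹) • H ^ j) (NormedSpace.exp H) := by
    let _ : NormedRing (Matrix ι ι ℝ) := Matrix.linftyOpNormedRing
    let _ : NormedAlgebra ℝ (Matrix ι ι ℝ) := Matrix.linftyOpNormedAlgebra
    exact NormedSpace.exp_series_hasSum_exp' H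
  have hK : HasSum (fun j : ℕ => ((j.factorial : ℝ)⁻¹) • K ^ j) (NormedSpace.exp K) := by
    let _ : NormedRing (Matrix κ κ ℝ) := Matrix.linftyOpNormedRing
    let _ : NormedAlgebra ℝ (Matrix κ κ ℝ) := Matrix.linftyOpNormedAlgebra
    exact NormedSpace.exp_series_hasSum_exp' K
  have h1 := hH.map (Matrix.addMonoidHomMulRight W) (by
    change Continuous fun M : Matrix ι ι ℝ => M * W
    fun_prop)
  have h2 := hK.map (Matrix.addMonoidHomMulLeft W) (by
    change Continuous fun M : Matrix κ κ ℝ => W * M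
    fun_prop)
  refine h1.unique (h2.congr_fun ?_)
  intro j
  simp [Matrix.addMonoidHomMulRight, Matrix.addMonoidHomMulLeft, hpow]

variable {m : ℕ} {n : Fin m → ℕ} {p r : ℕ}

theorem mul_idCols_apply {ι : Type*} (M : Matrix ι (Idx n p) ℝ) (i : ι) (j : Head n) :
    (M * idCols n p) i j = M i (Sum.inl j) := by
  simp [idCols, Matrix.mul_apply, Fintype.sum_sum_type, Matrix.one_apply]

/-- An orthonormal `N × k` matrix consists of the first `k` columns of a special orthogonal matrix.
The sign of the determinant is adjusted in one of the `p` added columns; the case `p = 0` is only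
allowed when `k = 0`. -/
theorem exists_specialOrthogonal_mul_idCols (hp : p = 0 → IsEmpty (Head n))
    (X : Matrix (Idx n p) (Head n) ℝ) (hX : Xᵀ * X = 1) :
    ∃ Q ∈ specialOrthogonalGroup (Idx n p) ℝ, Q * idCols n p = X := by
  obtain ⟨Q, hQ, hQX⟩ : ∃ Q ∈ orthogonalGroup (Idx n p) ℝ, Q * idCols n p = X := by
    let v : Idx n p → EuclideanSpace ℝ (Idx n p) :=
      Sum.elim (fun j => WithLp.toLp 2 (fun i => X i j)) 0
    have hv : Orthonormal ℝ ((Set.range (Sum.inl : Head n → Idx n p)).domRestrict v) := by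
      rw [orthonormal_iff_ite]
      rintro ⟨_, i, rfl⟩ ⟨_, j, rfl⟩
      have := congrFun (congrFun hX j) i
      simp only [Matrix.mul_apply, transpose_apply, Matrix.one_apply] at this
      have hij : ((⟨Sum.inl i, ⟨i, rfl⟩⟩ : Set.range (Sum.inl : Head n → Idx n p)) =
          ⟨Sum.inl j, ⟨j, rfl⟩⟩) ↔ j = i :=
        Subtype.mk_eq_mk.trans (Sum.inl_injective.eq_iff.trans eq_comm)
      refine Eq.trans ?_ (this.trans (if_congr hij.symm rfl rfl))
      simp [v, Set.domRestrict, PiLp.inner_apply]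
    obtain ⟨b, hb⟩ := hv.exists_orthonormalBasis_extension_of_card_eq (by simp)
    refine ⟨of fun i j => b j i, ?_, ?_⟩
    · rw [mem_orthogonalGroup_iff']
      ext i j
      have := orthonormal_iff_ite.1 b.orthonormal j i
      simpa [Matrix.mul_apply, Matrix.one_apply, PiLp.inner_apply, star_eq_conjTranspose,
        eq_comm] using this
    · ext i j
      rw [mul_idCols_apply]
      simp [hb _ ⟨j, rfl⟩, v]
  rcases p with _ | p
  · have := hp rfl
    exact ⟨1, one_mem _, by ext i j; exact isEmptyElim j⟩
  · let E : Matrix (Idx n (p + 1)) (Idx n (p + 1)) ℝ :=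
      diagonal (fun i => if i = Sum.inr 0 then Q.det else 1)
    have hdet : Q.det * Q.det = 1 := by
      have := congrArg Matrix.det ((mem_orthogonalGroup_iff _ ℝ).1 hQ)
      simpa [star_eq_conjTranspose] using this
    refine ⟨Q * E, ?_, ?_⟩
    · rw [mem_specialOrthogonalGroup_iff]
      refine ⟨mul_mem hQ ?_, ?_⟩
      · rw [mem_orthogonalGroup_iff]
        change E * Eᵀ = 1
        rw [diagonal_transpose, diagonal_mul_diagonal, ← diagonal_one]
        congr 1
        ext i
        by_cases hi : i = Sum.inr 0 <;> simp [hi, hdet]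
      · simp [E, det_diagonal, Finset.prod_ite_eq', hdet]
    · rw [← hQX]
      ext i j
      simp [mul_idCols_apply, E]

theorem orthogonal_transpose_mul {ι : Type*} [Fintype ι] [DecidableEq ι] {Q : Matrix ι ι ℝ}
    (hQ : Q ∈ specialOrthogonalGroup ι ℝ) : Qᵀ * Q = 1 := by
  have := (mem_orthogonalGroup_iff' _ ℝ).1 (mem_specialOrthogonalGroup_iff.1 hQ).1
  simpa [star_eq_conjTranspose] using this

theorem orthogonal_mul_transpose {ι : Type*} [Fintype ι] [DecidableEq ι] {Q : Matrix ι ι ℝ}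
    (hQ : Q ∈ specialOrthogonalGroup ι ℝ) : Q * Qᵀ = 1 :=
  mul_eq_one_comm.1 (orthogonal_transpose_mul hQ)

theorem mul_left_cancel_of_transpose_mul {ι κ l : Type*} [Fintype ι] [Fintype κ] [DecidableEq κ]
    {U : Matrix ι κ ℝ} (hU : Uᵀ * U = 1) {X Y : Matrix κ l ℝ} (h : U * X = U * Y) : X = Y := by
  simpa [← Matrix.mul_assoc, hU] using congrArg (Uᵀ * ·) h

/-- The range of `U` has dimension `2k ≤ k + p`, so that `p = 0` forces `k = 0`. -/
theorem isEmpty_head_of_isometry {U : Matrix (Idx n p) (Idx n (∑ i, n i)) ℝ} (hU : Uᵀ * U = 1) :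
    p = 0 → IsEmpty (Head n) := by
  rintro rfl
  have hinj : Function.Injective U.mulVecLin := by
    intro v w h
    have := congrArg (Uᵀ *ᵥ ·) h
    simpa [hU] using this
  have := LinearMap.finrank_le_finrank_of_injective hinj
  simp only [Module.finrank_fintype_fun_eq_card, Fintype.card_sum, Fintype.card_sigma,
    Fintype.card_fin] at this
  rw [← Fintype.card_eq_zero_iff]
  simp only [Fintype.card_sigma, Fintype.card_fin]
  omega

/-! ### Comparison of flows in adapted frames -/

/-- The `(k + p) × (k + r)` matrix `diag(1, V)`. -/
abbrev frameMatrix (n : Fin m → ℕ) (V : Matrix (Fin p) (Fin r) ℝ) :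
    Matrix (Idx n p) (Idx n r) ℝ :=
  fromBlocks 1 0 0 V

/-- The matrix `[A, -Bᵀ; B, 0]`. -/
abbrev horizontalMatrix (A : Matrix (Head n) (Head n) ℝ) (B : Matrix (Fin p) (Head n) ℝ) :
    Matrix (Idx n p) (Idx n p) ℝ :=
  fromBlocks A (-Bᵀ) B 0

theorem frameMatrix_mul_idCols (V : Matrix (Fin p) (Fin r) ℝ) :
    frameMatrix n V * idCols n r = idCols n p := by
  simp [idCols, fromBlocks_mul_fromRows]

/-- Two orthogonal frames with matching first blocks are related through a block diagonal
isometry `diag(1, V)`. -/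
theorem exists_blockDiag_frame {U : Matrix (Idx n p) (Idx n r) ℝ} (hU : Uᵀ * U = 1)
    {Q : Matrix (Idx n p) (Idx n p) ℝ} (hQ : Q ∈ specialOrthogonalGroup (Idx n p) ℝ)
    {Q' : Matrix (Idx n r) (Idx n r) ℝ} (hQ' : Q' ∈ specialOrthogonalGroup (Idx n r) ℝ)
    (h : Q * idCols n p = U * (Q' * idCols n r)) :
    ∃ V : Matrix (Fin p) (Fin r) ℝ, Vᵀ * V = 1 ∧ U * Q' = Q * frameMatrix n V := by
  set W : Matrix (Idx n p) (Idx n r) ℝ := Qᵀ * (U * Q') with hW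
  have hQW : Q * W = U * Q' := by
    rw [hW, ← Matrix.mul_assoc, orthogonal_mul_transpose hQ, Matrix.one_mul]
  have hWW : Wᵀ * W = 1 := by
    calc Wᵀ * W = Q'ᵀ * (Uᵀ * ((Q * Qᵀ) * U)) * Q' := by
          simp only [hW, transpose_mul, transpose_transpose, Matrix.mul_assoc]
      _ = 1 := by
          rw [orthogonal_mul_transpose hQ, Matrix.one_mul, hU, Matrix.mul_one,
            orthogonal_transpose_mul hQ']
  have hWI : W * idCols n r = idCols n p := by
    rw [hW, Matrix.mul_assoc, Matrix.mul_assoc, ← h, ← Matrix.mul_assoc,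
      orthogonal_transpose_mul hQ, Matrix.one_mul]
  have hWb := fromBlocks_toBlocks W
  have h11 : W.toBlocks₁₁ = 1 := by
    ext i j
    have := congrFun (congrFun hWI (Sum.inl i)) j
    rw [mul_idCols_apply] at this
    simpa [idCols, toBlocks₁₁] using this
  have h21 : W.toBlocks₂₁ = 0 := by
    ext i j
    have := congrFun (congrFun hWI (Sum.inr i)) j
    rw [mul_idCols_apply] at this
    simpa [idCols, toBlocks₂₁] using this
  rw [h11, h21] at hWb
  rw [← hWb, fromBlocks_transpose, fromBlocks_multiply, ← fromBlocks_one, fromBlocks_inj] at hWW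
  have h12 : W.toBlocks₁₂ = 0 := by simpa using hWW.2.1
  refine ⟨W.toBlocks₂₂, by simpa [h12] using hWW.2.2.2, ?_⟩
  rw [h12] at hWb
  rw [frameMatrix, hWb, hQW]

theorem blockDiag_intertwines (A : Matrix (Head n) (Head n) ℝ) {V : Matrix (Fin p) (Fin r) ℝ}
    (hV : Vᵀ * V = 1) (B' : Matrix (Fin r) (Head n) ℝ) :
    horizontalMatrix A (V * B') * frameMatrix n V =
      frameMatrix n V * horizontalMatrix A B' := by
  simp only [horizontalMatrix, frameMatrix, fromBlocks_multiply]
  simp [Matrix.mul_assoc, hV]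

theorem flow_eq_of_frame {U : Matrix (Idx n p) (Idx n r) ℝ}
    {Q : Matrix (Idx n p) (Idx n p) ℝ} {Q' : Matrix (Idx n r) (Idx n r) ℝ}
    {V : Matrix (Fin p) (Fin r) ℝ} (hV : Vᵀ * V = 1) (hUQ : U * Q' = Q * frameMatrix n V)
    (A : Matrix (Head n) (Head n) ℝ) (B' : Matrix (Fin r) (Head n) ℝ) (t : ℝ) :
    Q * NormedSpace.exp (t • horizontalMatrix A (V * B')) * idCols n p =
      U * (Q' * NormedSpace.exp (t • horizontalMatrix A B') * idCols n r) := by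
  have h : (t • horizontalMatrix A (V * B')) *
      frameMatrix n V = frameMatrix n V * (t • horizontalMatrix A B') := by
    rw [Matrix.smul_mul, Matrix.mul_smul, blockDiag_intertwines A hV]
  rw [← frameMatrix_mul_idCols (n := n) V, Matrix.mul_assoc, ← Matrix.mul_assoc _ _ (idCols n r),
    exp_mul_of_mul_eq_mul h]
  simp only [← Matrix.mul_assoc, hUQ]

theorem velocity_eq_of_frame {U : Matrix (Idx n p) (Idx n r) ℝ}
    {Q : Matrix (Idx n p) (Idx n p) ℝ} {Q' : Matrix (Idx n r) (Idx n r) ℝ}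
    {V : Matrix (Fin p) (Fin r) ℝ} (hV : Vᵀ * V = 1) (hUQ : U * Q' = Q * frameMatrix n V)
    (A : Matrix (Head n) (Head n) ℝ) (B' : Matrix (Fin r) (Head n) ℝ) :
    Q * horizontalMatrix A (V * B') * idCols n p =
      U * (Q' * horizontalMatrix A B' * idCols n r) := by
  rw [← frameMatrix_mul_idCols (n := n) V, Matrix.mul_assoc, ← Matrix.mul_assoc _ _ (idCols n r),
    blockDiag_intertwines A hV]
  simp only [← Matrix.mul_assoc, hUQ]

theorem trace_fromBlocks_eq {ι κ : Type*} [Fintype ι] [Fintype κ] (A : Matrix ι ι ℝ)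
    (B : Matrix ι κ ℝ) (C : Matrix κ ι ℝ) (D : Matrix κ κ ℝ) :
    (fromBlocks A B C D).trace = A.trace + D.trace := by
  simp [Matrix.trace, Fintype.sum_sum_type]

/-- The length only involves `AᵀA`, `BᵀB` and `Tr(BBᵀ) = Tr(BᵀB)`, and `(VB')ᵀ(VB') = B'ᵀB'`. -/
theorem tangentNorm_eq_of_isometry (A : Matrix (Head n) (Head n) ℝ)
    {V : Matrix (Fin p) (Fin r) ℝ} (hV : Vᵀ * V = 1) (B' : Matrix (Fin r) (Head n) ℝ) :
    tangentNorm (horizontalMatrix A (V * B')) = tangentNorm (horizontalMatrix A B') := by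
  have h1 : (V * B')ᵀ * (V * B') = B'ᵀ * B' := by
    rw [transpose_mul, Matrix.mul_assoc, ← Matrix.mul_assoc Vᵀ, hV, Matrix.one_mul]
  have h2 : ((V * B') * (V * B')ᵀ).trace = (B' * B'ᵀ).trace := by
    rw [trace_mul_comm, h1, trace_mul_comm]
  simp only [tangentNorm, fromBlocks_transpose, fromBlocks_multiply, h1,
    transpose_neg, transpose_transpose, Matrix.neg_mul, Matrix.mul_neg, neg_neg, trace_fromBlocks_eq, trace_add, h2]
  simp

/-! ### Lifting and restricting geodesic flows -/

/-- A geodesic flow of the small flag manifold is mapped by `U` to a geodesic flow. -/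
theorem IsGeodesicFlow.exists_lift {U : Matrix (Idx n p) (Idx n (∑ i, n i)) ℝ} (hU : Uᵀ * U = 1)
    {γ' : ℝ → Stiefel n (∑ i, n i)} {Q' H' : Matrix (Idx n (∑ i, n i)) (Idx n (∑ i, n i)) ℝ}
    (h : IsGeodesicFlow γ' Q' H') :
    ∃ (γ : ℝ → Stiefel n p) (Q H : Matrix (Idx n p) (Idx n p) ℝ), IsGeodesicFlow γ Q H ∧
      (∀ t, (γ t).1 = U * (γ' t).1) ∧ tangentNorm H = tangentNorm H' ∧
      Q * H * idCols n p = U * (Q' * H' * idCols n (∑ i, n i)) := by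
  obtain ⟨hQ', ⟨A, B', hA, hA0, rfl⟩, hγ'⟩ := h
  have horth : ∀ X : Stiefel n (∑ i, n i), (U * X.1)ᵀ * (U * X.1) = 1 := by
    intro X
    rw [transpose_mul, Matrix.mul_assoc, ← Matrix.mul_assoc Uᵀ, hU, Matrix.one_mul, X.2]
  have h0 : (γ' 0).1 = Q' * idCols n (∑ i, n i) := by simp [hγ']
  obtain ⟨Q, hQ, hQI⟩ := exists_specialOrthogonal_mul_idCols (isEmpty_head_of_isometry hU) _
    (horth (γ' 0))
  rw [h0] at hQI
  obtain ⟨V, hV, hUQ⟩ := exists_blockDiag_frame hU hQ hQ' hQI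
  refine ⟨fun t => ⟨U * (γ' t).1, horth _⟩, Q, horizontalMatrix A (V * B'),
    ⟨hQ, ⟨A, V * B', hA, hA0, rfl⟩, fun t => ?_⟩, fun t => rfl,
    tangentNorm_eq_of_isometry A hV B', velocity_eq_of_frame hV hUQ A B'⟩
  rw [flow_eq_of_frame hV hUQ, ← hγ']

/-- The columns of `[I; 0]` and `[0; B]` together span a subspace invariant under the horizontal
matrix `[A, -Bᵀ; B, 0]`, hence under its exponential. -/
theorem exists_exp_mul_idCols (A : Matrix (Head n) (Head n) ℝ) (B : Matrix (Fin p) (Head n) ℝ) :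
    ∃ E Z : Matrix (Head n) (Head n) ℝ,
      NormedSpace.exp (horizontalMatrix A B) * idCols n p = fromRows E (B * Z) := by
  let P : Matrix (Idx n p) (Head n ⊕ Head n) ℝ := fromBlocks 1 0 0 B
  let K : Matrix (Head n ⊕ Head n) (Head n ⊕ Head n) ℝ := fromBlocks A (-(Bᵀ * B)) 1 0
  have hPK : horizontalMatrix A B * P = P * K := by simp [P, K, fromBlocks_multiply]
  have hPI : P * (fromRows 1 0 : Matrix (Head n ⊕ Head n) (Head n) ℝ) = idCols n p := by
    simp [P, idCols, fromBlocks_mul_fromRows]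
  refine ⟨(NormedSpace.exp K).toBlocks₁₁, (NormedSpace.exp K).toBlocks₂₁, ?_⟩
  rw [← hPI, ← Matrix.mul_assoc, exp_mul_of_mul_eq_mul hPK, Matrix.mul_assoc]
  conv_lhs => rw [← fromBlocks_toBlocks (NormedSpace.exp K)]
  simp [P, fromBlocks_mul_fromRows]

/-- A geodesic flow whose end points have columns in the range of `U`, with independent column
spans, stays in the range of `U` and comes from a geodesic flow of the small flag manifold. -/
theorem IsGeodesicFlow.exists_restrict {U : Matrix (Idx n p) (Idx n (∑ i, n i)) ℝ}
    (hU : Uᵀ * U = 1) {γ : ℝ → Stiefel n p} {Q H : Matrix (Idx n p) (Idx n p) ℝ}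
    (h : IsGeodesicFlow γ Q H) {X₀ X₁ : Matrix (Idx n (∑ i, n i)) (Head n) ℝ}
    (h0 : (γ 0).1 = U * X₀) (h1 : (γ 1).1 = U * X₁)
    (hind : ∀ v w, (γ 0).1 *ᵥ v = (γ 1).1 *ᵥ w → w = 0) :
    ∃ (γ' : ℝ → Stiefel n (∑ i, n i))
      (Q' H' : Matrix (Idx n (∑ i, n i)) (Idx n (∑ i, n i)) ℝ), IsGeodesicFlow γ' Q' H' ∧
      (∀ t, (γ t).1 = U * (γ' t).1) ∧ tangentNorm H = tangentNorm H' ∧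
      Q * H * idCols n p = U * (Q' * H' * idCols n (∑ i, n i)) := by
  obtain ⟨hQ, ⟨A, B, hA, hA0, rfl⟩, hγ⟩ := h
  have horth : ∀ {X : Stiefel n p} {Y : Matrix (Idx n (∑ i, n i)) (Head n) ℝ},
      X.1 = U * Y → Yᵀ * Y = 1 := by
    intro X Y hXY
    have := X.2
    rwa [hXY, transpose_mul, Matrix.mul_assoc, ← Matrix.mul_assoc Uᵀ, hU, Matrix.one_mul] at this
  have hempty : (∑ i, n i) = 0 → IsEmpty (Head n) := by
    intro h
    rw [← Fintype.card_eq_zero_iff]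
    simpa using h
  obtain ⟨Q', hQ', hQX⟩ := exists_specialOrthogonal_mul_idCols hempty X₀ (horth h0)
  have hγ0 : (γ 0).1 = Q * idCols n p := by simp [hγ]
  obtain ⟨V, hV, hUQ⟩ := exists_blockDiag_frame hU hQ hQ'
    (show Q * idCols n p = U * (Q' * idCols n _) by rw [hQX, ← hγ0, h0])
  obtain ⟨E, Z, hEZ⟩ := exists_exp_mul_idCols A B
  have hγ1 : (γ 1).1 = Q * fromRows E (B * Z) := by
    rw [hγ, one_smul, Matrix.mul_assoc, hEZ]
  -- If `Z w = 0`, then `γ(1) w = γ(0) (E w)` lies in both spans.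
  have hZ : IsUnit Z := by
    rw [← mulVec_injective_iff_isUnit]
    refine (injective_iff_map_eq_zero Z.mulVecLin).2 fun w hw => ?_
    have hw : Z *ᵥ w = 0 := hw
    refine hind (E *ᵥ w) w ?_
    rw [hγ0, hγ1, ← mulVec_mulVec, ← mulVec_mulVec, fromRows_mulVec, ← mulVec_mulVec _ B Z, hw,
      idCols, fromRows_mulVec]
    simp
  -- In the frame `Q`, membership of `γ(1)` in the range of `U` reads `B Z = V Y₂`.
  have hBZ : ∃ Y : Matrix (Fin (∑ i, n i)) (Head n) ℝ, B * Z = V * Y := by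
    let Y := Q'ᵀ * X₁
    have hY : U * Q' * Y = U * X₁ := by
      rw [Matrix.mul_assoc, ← Matrix.mul_assoc Q', orthogonal_mul_transpose hQ', Matrix.one_mul]
    rw [← h1, hγ1, hUQ, Matrix.mul_assoc] at hY
    have hY := mul_left_cancel_of_transpose_mul (orthogonal_transpose_mul hQ) hY
    rw [← fromRows_toRows Y, fromBlocks_mul_fromRows, fromRows_inj.eq_iff] at hY
    exact ⟨Y.toRows₂, by simpa using hY.2.symm⟩
  obtain ⟨B', rfl⟩ : ∃ B' : Matrix (Fin (∑ i, n i)) (Head n) ℝ, B = V * B' := by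
    obtain ⟨Y, hY⟩ := hBZ
    refine ⟨Y * Z⁻¹, ?_⟩
    rw [← Matrix.mul_assoc, ← hY, Matrix.mul_assoc,
      Matrix.mul_nonsing_inv _ ((isUnit_iff_isUnit_det Z).1 hZ), Matrix.mul_one]
  have hflow := fun t => (hγ t).trans (flow_eq_of_frame hV hUQ A B' t)
  exact ⟨fun t => ⟨_, horth (hflow t)⟩, Q', horizontalMatrix A B',
    ⟨hQ', ⟨A, B', hA, hA0, rfl⟩, fun t => rfl⟩, hflow, tangentNorm_eq_of_isometry A hV B',
    velocity_eq_of_frame hV hUQ A B'⟩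

/-! ### Flags in the range of an isometry -/

theorem toFL_eq_iff {x y : Stiefel n p} : x.toFL = y.toFL ↔
    ∃ M : (i : Fin m) → Matrix (Fin (n i)) (Fin (n i)) ℝ,
      (∀ i, M i ∈ orthogonalGroup (Fin (n i)) ℝ) ∧ y.1 = x.1 * blockDiagonal' M :=
  ⟨fun h => Quotient.exact h, fun h => Quotient.sound h⟩

/-- Matrices with columns in the range of `U` represent the same flag exactly when their coordinate
matrices do. -/
theorem toFL_eq_iff_of_isometry {U : Matrix (Idx n p) (Idx n r) ℝ} (hU : Uᵀ * U = 1)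
    {x y : Stiefel n p} {x' y' : Stiefel n r} (hx : x.1 = U * x'.1) (hy : y.1 = U * y'.1) :
    x.toFL = y.toFL ↔ x'.toFL = y'.toFL := by
  simp only [toFL_eq_iff, hx, hy, Matrix.mul_assoc]
  refine exists_congr fun M => and_congr_right fun _ =>
    ⟨mul_left_cancel_of_transpose_mul hU, fun h => by rw [h]⟩

theorem exists_mul_of_toFL_eq {x y : Stiefel n p} (h : x.toFL = y.toFL) :
    ∃ M : Matrix (Head n) (Head n) ℝ, x.1 = y.1 * M := by
  obtain ⟨M, -, hM⟩ := toFL_eq_iff.1 h.symm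
  exact ⟨_, hM⟩

theorem mulVec_mem_colSpan {ι κ : Type} [Fintype κ] (M : Matrix ι κ ℝ) (v : κ → ℝ) :
    M *ᵥ v ∈ colSpan M := by
  rw [colSpan, ← range_mulVecLin]
  exact ⟨v, rfl⟩

/-- Independence of column spans only depends on the flags. -/
theorem eq_zero_of_mulVec_eq {x y x₁ y₁ : Stiefel n p}
    (hspan : colSpan x.1 ⊓ colSpan y.1 = ⊥) (hx : x₁.toFL = x.toFL) (hy : y₁.toFL = y.toFL)
    (v w : Head n → ℝ) (h : x₁.1 *ᵥ v = y₁.1 *ᵥ w) : w = 0 := by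
  obtain ⟨M, hM⟩ := exists_mul_of_toFL_eq hx
  obtain ⟨N, hN⟩ := exists_mul_of_toFL_eq hy
  have hmem : y₁.1 *ᵥ w ∈ colSpan x.1 ⊓ colSpan y.1 := by
    constructor
    · rw [← h, hM, ← mulVec_mulVec]
      exact mulVec_mem_colSpan _ _
    · rw [hN, ← mulVec_mulVec]
      exact mulVec_mem_colSpan _ _
  rw [hspan, Submodule.mem_bot] at hmem
  have := congrArg (y₁.1ᵀ *ᵥ ·) hmem
  simpa [y₁.2] using this

variable {U : Matrix (Idx n p) (Idx n (∑ i, n i)) ℝ} {x y : Stiefel n p}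
  {x' y' : Stiefel n (∑ i, n i)}

/-- Every geodesic flow joining the flags `[x]` and `[y]` comes from a geodesic flow of the small
flag manifold. -/
theorem IsGeodesicFlow.exists_restrict_of_toFL (hU : Uᵀ * U = 1)
    (hx : x.1 = U * x'.1) (hy : y.1 = U * y'.1) (hspan : colSpan x.1 ⊓ colSpan y.1 = ⊥)
    {γ : ℝ → Stiefel n p} {Q H : Matrix (Idx n p) (Idx n p) ℝ} (h : IsGeodesicFlow γ Q H)
    (h0 : (γ 0).toFL = x.toFL) (h1 : (γ 1).toFL = y.toFL) :
    ∃ (γ' : ℝ → Stiefel n (∑ i, n i))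
      (Q' H' : Matrix (Idx n (∑ i, n i)) (Idx n (∑ i, n i)) ℝ), IsGeodesicFlow γ' Q' H' ∧
      (∀ t, (γ t).1 = U * (γ' t).1) ∧ tangentNorm H = tangentNorm H' ∧
      Q * H * idCols n p = U * (Q' * H' * idCols n (∑ i, n i)) := by
  obtain ⟨M, hM⟩ := exists_mul_of_toFL_eq h0
  obtain ⟨N, hN⟩ := exists_mul_of_toFL_eq h1
  rw [hx, Matrix.mul_assoc] at hM
  rw [hy, Matrix.mul_assoc] at hN
  exact h.exists_restrict hU hM hN (eq_zero_of_mulVec_eq hspan h0 h1)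

theorem flagDist_eq_of_isometry (hU : Uᵀ * U = 1) (hx : x.1 = U * x'.1) (hy : y.1 = U * y'.1)
    (hspan : colSpan x.1 ⊓ colSpan y.1 = ⊥) :
    flagDist x'.toFL y'.toFL = flagDist x.toFL y.toFL := by
  unfold flagDist
  congr 1
  ext l
  constructor
  · rintro ⟨γ', Q', H', hγ', h0, h1, rfl⟩
    obtain ⟨γ, Q, H, hγ, hlift, hnorm, -⟩ := hγ'.exists_lift hU
    exact ⟨γ, Q, H, hγ, (toFL_eq_iff_of_isometry hU (hlift 0) hx).2 h0,
      (toFL_eq_iff_of_isometry hU (hlift 1) hy).2 h1, hnorm.symm⟩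
  · rintro ⟨γ, Q, H, hγ, h0, h1, rfl⟩
    obtain ⟨γ', Q', H', hγ', hlift, hnorm, -⟩ := hγ.exists_restrict_of_toFL hU hx hy hspan h0 h1
    exact ⟨γ', Q', H', hγ', (toFL_eq_iff_of_isometry hU (hlift 0) hx).1 h0,
      (toFL_eq_iff_of_isometry hU (hlift 1) hy).1 h1, hnorm⟩

theorem flagLog_eq_image_of_isometry (hU : Uᵀ * U = 1) (hx : x.1 = U * x'.1)
    (hy : y.1 = U * y'.1) (hspan : colSpan x.1 ⊓ colSpan y.1 = ⊥) :
    flagLog x y = (fun D => U * D) '' flagLog x' y' := by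
  have hdist := flagDist_eq_of_isometry hU hx hy hspan
  ext D
  constructor
  · rintro ⟨γ, Q, H, hγ, h0, h1, hmin, rfl⟩
    obtain ⟨γ', Q', H', hγ', hlift, hnorm, hvel⟩ :=
      hγ.exists_restrict_of_toFL hU hx hy hspan (congrArg Stiefel.toFL h0) h1
    refine ⟨_, ⟨γ', Q', H', hγ', ?_, (toFL_eq_iff_of_isometry hU (hlift 1) hy).1 h1,
      by rw [← hnorm, hmin, hdist], rfl⟩, hvel.symm⟩
    refine Subtype.ext (mul_left_cancel_of_transpose_mul hU ?_)
    rw [← hlift, h0, hx]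
  · rintro ⟨_, ⟨γ', Q', H', hγ', h0, h1, hmin, rfl⟩, rfl⟩
    obtain ⟨γ, Q, H, hγ, hlift, hnorm, hvel⟩ := hγ'.exists_lift hU
    refine ⟨γ, Q, H, hγ, Subtype.ext ?_, (toFL_eq_iff_of_isometry hU (hlift 1) hy).2 h1,
      by rw [hnorm, hmin, hdist], hvel.symm⟩
    rw [hlift, h0, hx]

end FlagGeod

theorem mainTheorem2 {m : ℕ} (n : Fin m → ℕ) (p : ℕ)
    -- the geodesic flow `q(t) = exp(tH) I_{N,k}` with `q(0) = I_{N,k}`, on `FL(n₁, …, n_m, p)`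
    (H : Matrix (FlagGeod.Idx n p) (FlagGeod.Idx n p) ℝ)
    (q : ℝ → FlagGeod.Stiefel n p)
    (hq : FlagGeod.IsGeodesicFlow q 1 H)
    (hspan : FlagGeod.colSpan (q 0).1 ⊓ FlagGeod.colSpan (q 1).1 = ⊥)
    -- `U R = [I_{N,k}, q(1)]` with `U` an `N × 2k` matrix with orthonormal columns;
    -- a compact QR decomposition is the case of an upper triangular `R`
    (U : Matrix (FlagGeod.Idx n p) (FlagGeod.Idx n (∑ i, n i)) ℝ)
    (R : Matrix (FlagGeod.Idx n (∑ i, n i)) (FlagGeod.Head n ⊕ FlagGeod.Head n) ℝ)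
    (hU : U.transpose * U = 1)
    (hUR : U * R = Matrix.fromCols (FlagGeod.idCols n p) (q 1).1) :
    ∃ φ : ℝ → FlagGeod.Stiefel n (∑ i, n i),
      (∀ t : ℝ, (φ t).1 = U.transpose * (q t).1) ∧
      (∃ Q' H' : Matrix (FlagGeod.Idx n (∑ i, n i)) (FlagGeod.Idx n (∑ i, n i)) ℝ,
        FlagGeod.IsGeodesicFlow φ Q' H') ∧
      FlagGeod.IsGeodesic (fun t => (φ t).toFL) ∧
      FlagGeod.flagDist (φ 0).toFL (φ 1).toFL = FlagGeod.flagDist (q 0).toFL (q 1).toFL ∧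
      (∀ t : ℝ, (q t).1 = U * (φ t).1) ∧
      FlagGeod.flagLog (q 0) (q 1) = (fun D => U * D) '' FlagGeod.flagLog (φ 0) (φ 1) := by
  -- The two column blocks of `R` give the coordinates of the end points in the range of `U`.
  have h0 : (q 0).1 = U * R.toCols₁ := by
    have h := congrArg Matrix.toCols₁ hUR
    rw [Matrix.toCols₁_fromCols] at h
    rw [hq.2.2 0]
    simp only [zero_smul, NormedSpace.exp_zero, Matrix.mul_one, Matrix.one_mul]
    rw [← h]
    rfl
  have h1 : (q 1).1 = U * R.toCols₂ := by
    have h := congrArg Matrix.toCols₂ hUR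
    rw [Matrix.toCols₂_fromCols] at h
    rw [← h]
    rfl
  obtain ⟨φ, Q', H', hφ, hlift, -, -⟩ := hq.exists_restrict hU h0 h1
    (FlagGeod.eq_zero_of_mulVec_eq hspan rfl rfl)
  refine ⟨φ, fun t => ?_, ⟨Q', H', hφ⟩, ⟨φ, Q', H', hφ, fun _ => rfl⟩,
    FlagGeod.flagDist_eq_of_isometry hU (hlift 0) (hlift 1) hspan, hlift,
    FlagGeod.flagLog_eq_image_of_isometry hU (hlift 0) (hlift 1) hspan⟩
  rw [hlift, ← Matrix.mul_assoc, hU, Matrix.one_mul]
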